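/- Let $G$ be a connected (finite, simple) graph of order $n$ with clique number $\omega$. Write $\partial^L_1$ for the largest eigenvalue of the distance Laplacian matrix $\mathrm{diag}(\mathrm{Tr}(v))-D$, where $D$ is the distance matrix and $\mathrm{Tr}(v)$ is the sum of the distances from $v$ to all vertices, and write $T_{n,\omega}$ for the Turán graph, i.e. the complete $\omega$-partite graph on $n$ vertices whose parts have size $\lceil n/\omega\rceil$ or $\lfloor n/\omega\rfloor$. Then $$\partial^L_1(G)\ \geq\ \partial^L_1(T_{n,\omega}),$$ and if $G$ is not complete, then $\partial^L_1(T_{n,\omega})=n+\lceil n/\omega\rceil$. Moreover, if $n=k\omega$ or $n=k\omega-1$ for some integer $k$, then $\partial^L_1(G)=\partial^L_1(T_{n,\omega})$ if and only if $G\cong T_{n,\omega}$. If $n=(k-1)\omega+t$ with integers $k,t$ and $0<t<\omega-1$, then $\partial^L_1(G)=\partial^L_1(T_{n,\omega})$ if and only if $G\cong H_1\vee\cdots\vee H_t\vee H$, where $\vee$ denotes the join of graphs, each $H_i$ $(1\le i\le t)$ is an edgeless graph of order $k$, and $H$ is a graph of order $n-kt$ with clique number $\omega-t$ and algebraic connectivity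 (second smallest eigenvalue of the Laplacian matrix, counted with multiplicity) at least $n-k(t+1)$. -/

import Mathlib

namespace SimpleGraph

/-- The transmission of `v`: the sum of the distances from `v` to all vertices. -/
noncomputable def transmission {V : Type*} [Fintype V] (G : SimpleGraph V) (v : V) : ℝ :=
  ∑ u, (G.dist v u : ℝ)

open Classical in
/-- The distance Laplacian matrix `Tr(G) - D(G)`. -/
noncomputable def distLapMatrix {V : Type*} [Fintype V] (G : SimpleGraph V) : Matrix V V ℝ :=
  Matrix.diagonal G.transmission - Matrix.of fun u v => (G.dist u v : ℝ)

theorem isHermitian_distLapMatrix {V : Type*} [Fintype V] (G : SimpleGraph V) :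
    G.distLapMatrix.IsHermitian := by
  classical
  unfold distLapMatrix
  refine Matrix.IsHermitian.sub (Matrix.isHermitian_diagonal _) ?_
  ext u v
  simp [Matrix.conjTranspose_apply, SimpleGraph.dist_comm]

open Classical in
/-- The distance Laplacian spectral radius: the largest eigenvalue of the distance Laplacian
matrix (`eigenvalues₀` lists the eigenvalues with multiplicity in decreasing order); the value
on a graph without vertices is a convention. -/
noncomputable def distLapRadius {V : Type*} [Fintype V] (G : SimpleGraph V) : ℝ :=
  if h : 0 < Fintype.card V then
    G.isHermitian_distLapMatrix.eigenvalues₀ ⟨0, h⟩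
  else 0

open Classical in
/-- The algebraic connectivity: the second smallest eigenvalue (with multiplicity) of the Laplacian
matrix; the value on a graph with fewer than two vertices is a convention. -/
noncomputable def algConnectivity {V : Type*} [Fintype V] (G : SimpleGraph V) : ℝ :=
  if h : 2 ≤ Fintype.card V then
    (G.isHermitian_lapMatrix ℝ).eigenvalues₀ ⟨Fintype.card V - 2, by omega⟩
  else 0

/-- The join of two graphs: their disjoint union together with all edges between the two. -/
def graphJoin {V W : Type*} (G : SimpleGraph V) (H : SimpleGraph W) : SimpleGraph (V ⊕ W) :=
  (G ⊕g H) ⊔ completeBipartiteGraph V W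

/-- The join of a family of graphs: their disjoint union together with all edges between
different members of the family. -/
def iJoin {ι : Type*} {V : ι → Type*} (G : ∀ i, SimpleGraph (V i)) :
    SimpleGraph (Σ i, V i) where
  Adj x y := x.1 ≠ y.1 ∨ ∃ i a b, x = ⟨i, a⟩ ∧ y = ⟨i, b⟩ ∧ (G i).Adj a b
  symm := ⟨by
    rintro x y (h | ⟨i, a, b, hx, hy, h⟩)
    · exact Or.inl h.symm
    · exact Or.inr ⟨i, b, a, hy, hx, h.symm⟩⟩
  loopless := ⟨by
    rintro x (h | ⟨i, a, b, hx, hy, h⟩)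
    · exact h rfl
    · rw [hx] at hy
      obtain rfl := eq_of_heq (Sigma.mk.inj hy).2
      exact (G i).loopless.irrefl a h⟩

end SimpleGraph

/-!
Write `n` for the order of `G`, and `N(v)` for the set of vertices not adjacent to `v`, with `v`
itself. The distance Laplacian has the quadratic form `∑ d(u, v) (x u - x v) ^ 2` over the
unordered pairs. In a connected graph distinct non-adjacent vertices are at distance at least `2`,
so on vectors of sum zero this form is at least `n |x| ^ 2` plus the Laplacian form of the
complement, with equality when the diameter is at most `2`. Everything thus reduces to the
Laplacian form of the complement, which is (half of) `SimpleGraph.nonadjForm`.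

Let `G` be non-complete; a complete graph is its own Turán graph.

*Lower bound.* The vector with value `#N(v) - 1` at `v`, `-1` on the rest of `N(v)` and `0`
elsewhere shows that the radius is at least `n + #N(v)`, as soon as `#N(v) ≥ 2`; the inequality is
strict if an edge of the complement leaves `N(v)` (`Connected.rayleigh_test_vector`). Picking
vertices of a clique greedily gives a `v` with `#N(v) ≥ n / ω`, and for the Turán graph the
resulting bound `n + ⌈n / ω⌉` is attained, since its complement is a union of cliques of at most
that size.

*Equality.* Put `k = ⌈n / ω⌉`, `n = (k - 1) ω + t` with `0 < t ≤ ω`. If the radius is `n + k`,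
then all `#N(v)` are at most `k`, and those of size `k` are components of the complement. A
refined greedy argument (`exists_isClique_and_classes`) gives a clique `I` with
`n ≤ (k - 1) #I + c`, where `c` is the number of components of the complement that are complete of
order `k`; as `#I ≤ ω`, there are at least `t` of them. Hence `G` is the join of `t` edgeless
graphs of order `k` and a graph `H` (`Connected.exists_iso_edgelessJoin`), whose clique number is
`ω - t`, and the bound on the form of the complement restricted to `H` is the bound on the
algebraic connectivity. Conversely, such a join has diameter at most `2` and the form of its
complement splits. When `ω - t ≤ 1`, the graph `H` is edgeless, so that `G` and the Turán graph,
to which all this applies too, are the same join.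
-/

/-! ### Extreme eigenvalues of a real symmetric matrix through its quadratic form -/

namespace Matrix.IsHermitian

open Matrix

variable {n : Type*} [Fintype n] [DecidableEq n] {A : Matrix n n ℝ}

/-- The coordinates of a vector in the orthonormal basis of eigenvectors. -/
noncomputable def eigenCoord (hA : A.IsHermitian) (x : n → ℝ) (i : n) : ℝ :=
  (hA.eigenvectorBasis i).ofLp ⬝ᵥ x

lemma dotProduct_eq_sum_eigenCoord (hA : A.IsHermitian) (x y : n → ℝ) :
    x ⬝ᵥ y = ∑ i, hA.eigenCoord x i * hA.eigenCoord y i := by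
  have h := hA.eigenvectorBasis.sum_inner_mul_inner (WithLp.toLp 2 x) (WithLp.toLp 2 y)
  simp only [EuclideanSpace.inner_eq_star_dotProduct, star_trivial] at h
  rw [dotProduct_comm, ← h]
  refine Finset.sum_congr rfl fun i _ => ?_
  simp only [eigenCoord, dotProduct_comm]

lemma eigenCoord_mulVec (hA : A.IsHermitian) (x : n → ℝ) (i : n) :
    hA.eigenCoord (A *ᵥ x) i = hA.eigenvalues i * hA.eigenCoord x i := by
  have hT : Aᵀ = A := by simpa [conjTranspose_eq_transpose_of_trivial] using hA.eq
  rw [eigenCoord, dotProduct_mulVec, ← mulVec_transpose, hT, hA.mulVec_eigenvectorBasis,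
    smul_dotProduct, smul_eq_mul, eigenCoord]

lemma dotProduct_mulVec_eq_sum (hA : A.IsHermitian) (x : n → ℝ) :
    x ⬝ᵥ A *ᵥ x = ∑ i, hA.eigenvalues i * hA.eigenCoord x i ^ 2 := by
  rw [hA.dotProduct_eq_sum_eigenCoord]
  refine Finset.sum_congr rfl fun i _ => ?_
  rw [eigenCoord_mulVec]
  ring

lemma dotProduct_self_eq_sum (hA : A.IsHermitian) (x : n → ℝ) :
    x ⬝ᵥ x = ∑ i, hA.eigenCoord x i ^ 2 := by
  rw [hA.dotProduct_eq_sum_eigenCoord]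
  exact Finset.sum_congr rfl fun i _ => (sq _).symm

lemma eigenCoord_eigenvectorBasis (hA : A.IsHermitian) (i j : n) :
    hA.eigenCoord (hA.eigenvectorBasis i).ofLp j = if i = j then 1 else 0 := by
  have h := (orthonormal_iff_ite.mp hA.eigenvectorBasis.orthonormal) i j
  simpa [EuclideanSpace.inner_eq_star_dotProduct, eigenCoord] using h

lemma eigenvalues_equivOfCardEq (hA : A.IsHermitian) (i : Fin (Fintype.card n)) :
    hA.eigenvalues (Fintype.equivOfCardEq (Fintype.card_fin _) i) = hA.eigenvalues₀ i := by
  simp [eigenvalues]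

/-- The largest eigenvalue is the maximum of the Rayleigh quotient. -/
theorem eigenvalues₀_zero_le_iff (hA : A.IsHermitian) (h : 0 < Fintype.card n) (c : ℝ) :
    hA.eigenvalues₀ ⟨0, h⟩ ≤ c ↔ ∀ x : n → ℝ, x ⬝ᵥ A *ᵥ x ≤ c * (x ⬝ᵥ x) := by
  constructor
  · intro hc x
    rw [hA.dotProduct_mulVec_eq_sum, hA.dotProduct_self_eq_sum, Finset.mul_sum]
    refine Finset.sum_le_sum fun i _ => mul_le_mul_of_nonneg_right ?_ (sq_nonneg _)
    refine le_trans (hA.eigenvalues₀_antitone ?_) hc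
    exact Fin.mk_le_of_le_val (Nat.zero_le _)
  · intro H
    have := H (hA.eigenvectorBasis (Fintype.equivOfCardEq (Fintype.card_fin _) ⟨0, h⟩)).ofLp
    simpa [hA.dotProduct_mulVec_eq_sum, hA.dotProduct_self_eq_sum, eigenCoord_eigenvectorBasis,
      eigenvalues_equivOfCardEq] using this

/-- If `A` is positive semidefinite and annihilates the constant vectors, its second smallest
eigenvalue is the minimum of the Rayleigh quotient over the vectors of sum zero. -/
theorem le_eigenvalues₀_card_sub_two_iff (hA : A.IsHermitian) (h : 2 ≤ Fintype.card n)
    (hpos : ∀ x : n → ℝ, 0 ≤ x ⬝ᵥ A *ᵥ x) (hone : A *ᵥ 1 = 0) (c : ℝ) :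
    c ≤ hA.eigenvalues₀ ⟨Fintype.card n - 2, by omega⟩ ↔
      ∀ x : n → ℝ, ∑ i, x i = 0 → c * (x ⬝ᵥ x) ≤ x ⬝ᵥ A *ᵥ x := by
  set e : Fin (Fintype.card n) ≃ n := Fintype.equivOfCardEq (Fintype.card_fin _) with he
  set p : Fin (Fintype.card n) := ⟨Fintype.card n - 2, by omega⟩ with hp
  set q : Fin (Fintype.card n) := ⟨Fintype.card n - 1, by omega⟩ with hq
  have hpq : e p ≠ e q := fun hh => by
    have := congrArg Fin.val (e.injective hh)
    simp only [hp, hq] at this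
    omega
  have hsum (x : n → ℝ) : ∑ i, x i = ∑ i, hA.eigenCoord 1 i * hA.eigenCoord x i := by
    rw [← hA.dotProduct_eq_sum_eigenCoord, one_dotProduct]
  constructor
  · intro hc x hx
    rcases le_or_gt c 0 with hc0 | hc0
    · exact (mul_nonpos_of_nonpos_of_nonneg hc0
        (by rw [hA.dotProduct_self_eq_sum]; positivity)).trans (hpos x)
    have hlam : ∀ j, j ≠ e q → c ≤ hA.eigenvalues j := by
      intro j hj
      obtain ⟨i, rfl⟩ := e.surjective j
      rw [he, eigenvalues_equivOfCardEq]
      refine hc.trans (hA.eigenvalues₀_antitone ?_)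
      have : i ≠ q := fun hh => hj (by rw [hh])
      rw [Fin.le_def]
      have h2 : i.val ≠ Fintype.card n - 1 := fun hh => this (Fin.ext hh)
      have := i.isLt
      simp only [hp]
      omega
    -- The constant vector lies in the kernel, so it is orthogonal to every eigenvector of
    -- positive eigenvalue: it spans the eigenline of the smallest eigenvalue.
    have h1 : ∀ j, j ≠ e q → hA.eigenCoord 1 j = 0 := by
      intro j hj
      have h2 := hA.eigenCoord_mulVec 1 j
      rw [hone] at h2
      have h3 : hA.eigenvalues j ≠ 0 := (hc0.trans_le (hlam j hj)).ne'
      simpa [eigenCoord, h3] using h2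
    have h1q : hA.eigenCoord 1 (e q) ≠ 0 := by
      intro h0
      have h2 := hA.dotProduct_self_eq_sum 1
      rw [Finset.sum_eq_zero fun j _ => by
        by_cases hj : j = e q
        · rw [hj, h0]; norm_num
        · rw [h1 j hj]; norm_num] at h2
      rw [one_dotProduct_one] at h2
      have : Fintype.card n = 0 := by exact_mod_cast h2
      omega
    have hxq : hA.eigenCoord x (e q) = 0 := by
      rw [hsum, Finset.sum_eq_single (e q) (fun j _ hj => by rw [h1 j hj, zero_mul])
        (fun hh => absurd (Finset.mem_univ _) hh)] at hx
      exact (mul_eq_zero.mp hx).resolve_left h1q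
    rw [hA.dotProduct_mulVec_eq_sum, hA.dotProduct_self_eq_sum, Finset.mul_sum]
    refine Finset.sum_le_sum fun j _ => ?_
    by_cases hj : j = e q
    · rw [hj, hxq]; norm_num
    · exact mul_le_mul_of_nonneg_right (hlam j hj) (sq_nonneg _)
  · intro H
    -- The span of the two last eigenvectors contains a nonzero vector of sum zero.
    obtain ⟨a, b, hab, hperp⟩ : ∃ a b : ℝ, 0 < a ^ 2 + b ^ 2 ∧
        hA.eigenCoord 1 (e p) * a + hA.eigenCoord 1 (e q) * b = 0 := by
      by_cases h0 : hA.eigenCoord 1 (e p) = 0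
      · exact ⟨1, 0, by norm_num, by simp [h0]⟩
      · exact ⟨-hA.eigenCoord 1 (e q), hA.eigenCoord 1 (e p), by positivity, by ring⟩
    set x : n → ℝ := a • (hA.eigenvectorBasis (e p)).ofLp + b • (hA.eigenvectorBasis (e q)).ofLp
      with hx
    have hcoord : ∀ j, hA.eigenCoord x j =
        (if e p = j then a else 0) + if e q = j then b else 0 := by
      intro j
      have h2 := hA.eigenCoord_eigenvectorBasis (e p) j
      have h3 := hA.eigenCoord_eigenvectorBasis (e q) j
      rw [eigenCoord] at h2 h3
      rw [eigenCoord, hx, dotProduct_add, dotProduct_smul, dotProduct_smul, h2, h3]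
      simp
    have hsq : ∀ j, hA.eigenCoord x j ^ 2 =
        (if e p = j then a ^ 2 else 0) + if e q = j then b ^ 2 else 0 := by
      intro j
      rw [hcoord]
      by_cases h2 : e p = j
      · have h3 : e q ≠ j := fun h3 => hpq (h2.trans h3.symm)
        simp [h2, h3]
      · simp [h2]
    have h2 := H x (by
      rw [hsum]
      simpa [hcoord, mul_add, Finset.sum_add_distrib] using hperp)
    rw [hA.dotProduct_mulVec_eq_sum, hA.dotProduct_self_eq_sum] at h2
    simp only [hsq, mul_add, Finset.sum_add_distrib, mul_ite, mul_zero, Finset.sum_ite_eq,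
      Finset.mem_univ, if_true] at h2
    rw [he, eigenvalues_equivOfCardEq, eigenvalues_equivOfCardEq] at h2
    have h3 : hA.eigenvalues₀ q ≤ hA.eigenvalues₀ p := hA.eigenvalues₀_antitone (by
      rw [Fin.le_def]; simp only [hp, hq]; omega)
    have h4 : c * (a ^ 2 + b ^ 2) ≤ hA.eigenvalues₀ p * (a ^ 2 + b ^ 2) := by
      nlinarith [mul_le_mul_of_nonneg_right h3 (sq_nonneg b)]
    exact le_of_mul_le_mul_right h4 hab

end Matrix.IsHermitian

/-! ### The quadratic form of the non-edges -/

namespace SimpleGraph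

open Matrix

/-- The quadratic form `∑ (x u - x v) ^ 2` over the ordered pairs of non-adjacent vertices, that is,
twice the Laplacian form of the complement (the diagonal pairs contribute zero). -/
noncomputable def nonadjForm {V : Type*} [Fintype V] (G : SimpleGraph V) (x : V → ℝ) : ℝ :=
  open Classical in ∑ u, ∑ v, if G.Adj u v then 0 else (x u - x v) ^ 2

variable {V W : Type*} [Fintype V] [Fintype W] {G : SimpleGraph V}

lemma sum_sum_sub_sq (x : V → ℝ) :
    ∑ u, ∑ v, (x u - x v) ^ 2 = 2 * (Fintype.card V * (x ⬝ᵥ x)) - 2 * (∑ u, x u) ^ 2 := by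
  have h : ∀ u v, (x u - x v) ^ 2 = x u * x u + x v * x v - 2 * (x u * x v) := fun u v => by ring
  simp only [h, Finset.sum_sub_distrib, Finset.sum_add_distrib, ← Finset.mul_sum,
    ← Finset.sum_mul, Finset.sum_const, Finset.card_univ, nsmul_eq_mul, dotProduct]
  ring_nf
  rw [← Finset.sum_mul]
  ring

lemma dotProduct_distLapMatrix_mulVec (G : SimpleGraph V) (x : V → ℝ) :
    x ⬝ᵥ G.distLapMatrix *ᵥ x = (∑ u, ∑ v, (G.dist u v : ℝ) * (x u - x v) ^ 2) / 2 := by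
  classical
  have h1 : x ⬝ᵥ G.distLapMatrix *ᵥ x =
      ∑ u, ∑ v, (G.dist u v : ℝ) * (x u * x u - x u * x v) := by
    rw [distLapMatrix, sub_mulVec, dotProduct_sub, dotProduct, dotProduct, ← Finset.sum_sub_distrib]
    refine Finset.sum_congr rfl fun u _ => ?_
    have hd : (diagonal G.transmission *ᵥ x) u = G.transmission u * x u := by
      rw [← mulVec_diagonal]
    rw [hd, transmission, mulVec, dotProduct, Finset.sum_mul, Finset.mul_sum, Finset.mul_sum,
      ← Finset.sum_sub_distrib]
    refine Finset.sum_congr rfl fun v _ => ?_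
    rw [of_apply]
    ring
  have h2 : ∑ u, ∑ v, (G.dist u v : ℝ) * (x u * x u - x u * x v) =
      ∑ u, ∑ v, (G.dist u v : ℝ) * (x v * x v - x u * x v) := by
    rw [Finset.sum_comm]
    refine Finset.sum_congr rfl fun u _ => Finset.sum_congr rfl fun v _ => ?_
    rw [dist_comm]
    ring
  have h3 : ∑ u, ∑ v, (G.dist u v : ℝ) * (x u - x v) ^ 2 =
      ∑ u, ∑ v, (G.dist u v : ℝ) * (x u * x u - x u * x v) +
        ∑ u, ∑ v, (G.dist u v : ℝ) * (x v * x v - x u * x v) := by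
    rw [← Finset.sum_add_distrib]
    refine Finset.sum_congr rfl fun u _ => ?_
    rw [← Finset.sum_add_distrib]
    exact Finset.sum_congr rfl fun v _ => by ring
  rw [h1, h3, ← h2]
  ring

theorem distLapRadius_le_iff [Nonempty V] (G : SimpleGraph V) (c : ℝ) :
    G.distLapRadius ≤ c ↔
      ∀ x : V → ℝ, (∑ u, ∑ v, (G.dist u v : ℝ) * (x u - x v) ^ 2) / 2 ≤ c * (x ⬝ᵥ x) := by
  classical
  rw [distLapRadius, dif_pos Fintype.card_pos, Matrix.IsHermitian.eigenvalues₀_zero_le_iff]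
  simp only [dotProduct_distLapMatrix_mulVec]

lemma Connected.nonadjForm_le_of_distLapRadius_le (hG : G.Connected) {c : ℝ}
    (hc : G.distLapRadius ≤ c) {x : V → ℝ} (hx : ∑ u, x u = 0) :
    Fintype.card V * (x ⬝ᵥ x) + G.nonadjForm x / 2 ≤ c * (x ⬝ᵥ x) := by
  classical
  have := hG.nonempty
  refine le_trans ?_ ((distLapRadius_le_iff G c).mp hc x)
  have h : ∑ u, ∑ v, (x u - x v) ^ 2 + G.nonadjForm x ≤
      ∑ u, ∑ v, (G.dist u v : ℝ) * (x u - x v) ^ 2 := by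
    rw [nonadjForm, ← Finset.sum_add_distrib]
    refine Finset.sum_le_sum fun u _ => ?_
    rw [← Finset.sum_add_distrib]
    refine Finset.sum_le_sum fun v _ => ?_
    by_cases huv : u = v
    · simp [huv]
    by_cases hadj : G.Adj u v
    · simp [hadj, dist_eq_one_iff_adj.mpr hadj]
    · have h2 : (2 : ℝ) ≤ G.dist u v := by
        exact_mod_cast hG.one_lt_dist_of_ne_of_not_adj huv hadj
      rw [if_neg hadj]
      nlinarith [sq_nonneg (x u - x v)]
  rw [sum_sum_sub_sq, hx] at h
  linarith

omit [Fintype V] in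
lemma dist_le_two_of_common_neighbor {G : SimpleGraph V} {u v w : V} (h1 : G.Adj u w)
    (h2 : G.Adj w v) : G.dist u v ≤ 2 :=
  dist_le (Walk.cons h1 (Walk.cons h2 Walk.nil))

lemma distLapRadius_le_of_dist_le_two [Nonempty V] (hd : ∀ u v, G.dist u v ≤ 2) {c : ℝ}
    (hc : ∀ x : V → ℝ, G.nonadjForm x ≤ 2 * (c * (x ⬝ᵥ x))) :
    G.distLapRadius ≤ Fintype.card V + c := by
  classical
  rw [distLapRadius_le_iff]
  intro x
  have h : ∑ u, ∑ v, (G.dist u v : ℝ) * (x u - x v) ^ 2 ≤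
      ∑ u, ∑ v, (x u - x v) ^ 2 + G.nonadjForm x := by
    rw [nonadjForm, ← Finset.sum_add_distrib]
    refine Finset.sum_le_sum fun u _ => ?_
    rw [← Finset.sum_add_distrib]
    refine Finset.sum_le_sum fun v _ => ?_
    by_cases hadj : G.Adj u v
    · simp [hadj, dist_eq_one_iff_adj.mpr hadj]
    · have h2 : (G.dist u v : ℝ) ≤ 2 := by exact_mod_cast hd u v
      rw [if_neg hadj]
      nlinarith [sq_nonneg (x u - x v)]
  rw [sum_sum_sub_sq] at h
  nlinarith [sq_nonneg (∑ u, x u), hc x]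

omit [Fintype V] [Fintype W] in
lemma Iso.dist_le {H : SimpleGraph W} (hG : G.Connected) (e : G ≃g H) (u v : V) :
    H.dist (e u) (e v) ≤ G.dist u v := by
  obtain ⟨p, hp⟩ := hG.exists_walk_length_eq_dist u v
  rw [← hp, ← Walk.length_map e.toHom p]
  exact SimpleGraph.dist_le _

lemma Iso.distLapRadius_le {H : SimpleGraph W} (hH : H.Connected) (e : G ≃g H) :
    G.distLapRadius ≤ H.distLapRadius := by
  have := hH.nonempty
  have : Nonempty V := e.toEquiv.nonempty
  rw [distLapRadius_le_iff]
  intro x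
  have h := (distLapRadius_le_iff H _).mp le_rfl (x ∘ e.symm)
  have h1 : (x ∘ e.symm) ⬝ᵥ (x ∘ e.symm) = x ⬝ᵥ x :=
    e.symm.toEquiv.sum_comp fun v => x v * x v
  rw [h1] at h
  refine le_trans (div_le_div_of_nonneg_right ?_ zero_le_two) h
  rw [← e.symm.toEquiv.sum_comp]
  refine Finset.sum_le_sum fun u _ => ?_
  rw [← e.symm.toEquiv.sum_comp]
  refine Finset.sum_le_sum fun v _ => ?_
  exact mul_le_mul_of_nonneg_right (by exact_mod_cast Iso.dist_le hH e.symm u v) (sq_nonneg _)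

lemma Iso.distLapRadius_eq {H : SimpleGraph W} (hH : H.Connected) (e : G ≃g H) :
    G.distLapRadius = H.distLapRadius :=
  le_antisymm (Iso.distLapRadius_le hH e) (Iso.distLapRadius_le (e.connected_iff.mpr hH) e.symm)

lemma dotProduct_lapMatrix_mulVec [DecidableEq V] [DecidableRel G.Adj] (x : V → ℝ) :
    x ⬝ᵥ G.lapMatrix ℝ *ᵥ x =
      Fintype.card V * (x ⬝ᵥ x) - (∑ u, x u) ^ 2 - G.nonadjForm x / 2 := by
  have h := G.lapMatrix_toLinearMap₂' ℝ x
  rw [toLinearMap₂'_apply'] at h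
  have h2 : ∑ u, ∑ v, (if G.Adj u v then (x u - x v) ^ 2 else 0) + G.nonadjForm x =
      ∑ u, ∑ v, (x u - x v) ^ 2 := by
    rw [nonadjForm, ← Finset.sum_add_distrib]
    refine Finset.sum_congr rfl fun u _ => ?_
    rw [← Finset.sum_add_distrib]
    refine Finset.sum_congr rfl fun v _ => ?_
    by_cases hadj : G.Adj u v <;> simp [hadj]
  rw [sum_sum_sub_sq] at h2
  rw [h]
  linarith

theorem card_sub_le_algConnectivity_iff (G : SimpleGraph V) (h : 2 ≤ Fintype.card V) (c : ℝ) :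
    Fintype.card V - c ≤ G.algConnectivity ↔
      ∀ x : V → ℝ, ∑ u, x u = 0 → G.nonadjForm x ≤ 2 * (c * (x ⬝ᵥ x)) := by
  classical
  rw [algConnectivity, dif_pos h,
    Matrix.IsHermitian.le_eigenvalues₀_card_sub_two_iff _ h]
  · refine forall_congr' fun x => forall_congr' fun hx => ?_
    rw [dotProduct_lapMatrix_mulVec, hx]
    constructor <;> intro h <;> linarith
  · intro x
    simpa using (G.posSemidef_lapMatrix ℝ).dotProduct_mulVec_nonneg x
  · exact G.lapMatrix_mulVec_const_eq_zero

/-- The form of the non-edges is invariant under translation by a constant, so a bound on the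
vectors of sum zero extends to all vectors. -/
lemma nonadjForm_le_of_sum_zero {c : ℝ} (hc : 0 ≤ c)
    (h : ∀ x : V → ℝ, ∑ u, x u = 0 → G.nonadjForm x ≤ 2 * (c * (x ⬝ᵥ x))) (x : V → ℝ) :
    G.nonadjForm x ≤ 2 * (c * (x ⬝ᵥ x)) := by
  classical
  rcases isEmpty_or_nonempty V with hV | hV
  · simp [nonadjForm, dotProduct]
  set m : ℝ := (∑ u, x u) / Fintype.card V with hm
  have hcard : (Fintype.card V : ℝ) ≠ 0 := by exact_mod_cast Fintype.card_ne_zero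
  have hsum : ∑ u, x u = Fintype.card V * m := by rw [hm]; field_simp
  have h1 := h (fun u => x u - m) (by simp [Finset.sum_sub_distrib, hsum])
  have h2 : G.nonadjForm (fun u => x u - m) = G.nonadjForm x := by
    simp only [nonadjForm, sub_sub_sub_cancel_right]
  have h3 : (fun u => x u - m) ⬝ᵥ (fun u => x u - m) = x ⬝ᵥ x - Fintype.card V * m ^ 2 := by
    have : ∀ u, (x u - m) * (x u - m) = x u * x u - 2 * m * x u + m ^ 2 := fun u => by ring
    simp only [dotProduct, this, Finset.sum_add_distrib, Finset.sum_sub_distrib, ← Finset.mul_sum,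
      hsum, Finset.sum_const, Finset.card_univ, nsmul_eq_mul]
    ring
  rw [h2, h3] at h1
  refine h1.trans ?_
  have : 0 ≤ (Fintype.card V : ℝ) * m ^ 2 := by positivity
  gcongr
  linarith

/-- If non-adjacency is contained in an equivalence relation with classes of size at most `k`,
then `k` bounds the Laplacian form of the complement. -/
lemma nonadjForm_le_of_fiber_card_le {ι : Type*} [Fintype ι] [DecidableEq ι] (f : V → ι) {k : ℕ}
    (hf : ∀ i, (Finset.univ.filter fun v => f v = i).card ≤ k)
    (hadj : ∀ u v, f u ≠ f v → G.Adj u v) (x : V → ℝ) :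
    G.nonadjForm x ≤ 2 * (k * (x ⬝ᵥ x)) := by
  classical
  have h1 : G.nonadjForm x ≤ ∑ u, ∑ v, if f v = f u then (x u - x v) ^ 2 else 0 := by
    refine Finset.sum_le_sum fun u _ => Finset.sum_le_sum fun v _ => ?_
    by_cases h : f v = f u
    · rw [if_pos h]
      split_ifs
      exacts [sq_nonneg _, le_rfl]
    · rw [if_neg h, if_pos (hadj u v (Ne.symm h))]
  have h2 : ∀ u v, (if f v = f u then (x u - x v) ^ 2 else 0) =
      (if f v = f u then x u * x u else 0) + (if f u = f v then x v * x v else 0) -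
        2 * ∑ i, (if f u = i then x u else 0) * (if f v = i then x v else 0) := by
    intro u v
    by_cases h : f v = f u
    · simp [h]; ring
    · have h' : f u ≠ f v := Ne.symm h
      simp [h, h']
  have h3 : ∑ u, ∑ v, (if f v = f u then x u * x u else 0) ≤ k * (x ⬝ᵥ x) := by
    rw [dotProduct, Finset.mul_sum]
    refine Finset.sum_le_sum fun u _ => ?_
    rw [← Finset.sum_filter, Finset.sum_const, nsmul_eq_mul]
    exact mul_le_mul_of_nonneg_right (by exact_mod_cast hf (f u)) (mul_self_nonneg _)
  have h4 : 0 ≤ ∑ u, ∑ v, ∑ i, (if f u = i then x u else 0) * (if f v = i then x v else 0) := by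
    have : ∑ u, ∑ v, ∑ i, (if f u = i then x u else 0) * (if f v = i then x v else 0) =
        ∑ i, (∑ u, if f u = i then x u else 0) ^ 2 := by
      simp_rw [sq, Finset.sum_mul_sum]
      rw [Finset.sum_comm (s := (Finset.univ : Finset ι))]
      exact Finset.sum_congr rfl fun u _ => Finset.sum_comm
    rw [this]
    exact Finset.sum_nonneg fun i _ => sq_nonneg _
  refine h1.trans ?_
  simp only [h2, Finset.sum_sub_distrib, Finset.sum_add_distrib, ← Finset.mul_sum]
  rw [Finset.sum_comm (f := fun u v => if f u = f v then x v * x v else 0)]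
  linarith

end SimpleGraph

/-! ### Non-neighbourhoods and the distance Laplacian radius -/

namespace SimpleGraph

open Matrix

open Classical in
/-- The vertices not adjacent to `v`, with `v` itself: the closed neighbourhood of `v` in the
complement. -/
noncomputable def nonNeighborFinset {V : Type*} [Fintype V] (G : SimpleGraph V) (v : V) :
    Finset V :=
  Finset.univ.filter fun u => ¬ G.Adj v u

section

variable {V : Type*} [Fintype V] {G : SimpleGraph V}

@[simp]
lemma mem_nonNeighborFinset {u v : V} : u ∈ G.nonNeighborFinset v ↔ ¬ G.Adj v u := by
  simp [nonNeighborFinset]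

lemma self_mem_nonNeighborFinset (v : V) : v ∈ G.nonNeighborFinset v := by simp

/-- The Rayleigh bound given by the vector with value `d` at `v`, `-1` at the `d` other vertices
not adjacent to `v`, and `0` elsewhere. The term `ε` is the contribution of a pair of non-adjacent
vertices `a`, `b` such that only `a` is a non-neighbour of `v`. -/
lemma Connected.rayleigh_test_vector (hG : G.Connected) {c : ℝ} (hc : G.distLapRadius ≤ c)
    {v a b : V} (hav : a ≠ v) (ha : ¬ G.Adj v a) {ε : ℝ}
    (hε : ε = 0 ∨ ε = 1 ∧ ¬ G.Adj a b ∧ G.Adj v b) :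
    let d : ℝ := (G.nonNeighborFinset v).card - 1
    Fintype.card V * (d * (d + 1)) +
      (d * (d + 1) ^ 2 + ε) ≤ c * (d * (d + 1)) := by
  classical
  intro d
  set N := G.nonNeighborFinset v with hN
  have hvN : v ∈ N := self_mem_nonNeighborFinset v
  have hcard : ((N.erase v).card : ℝ) = d := by
    rw [Finset.card_erase_of_mem hvN, Nat.cast_sub (Finset.card_pos.mpr ⟨v, hvN⟩)]
    simp [d, hN]
  set x : V → ℝ := fun u => (if u = v then d else 0) - (if u ∈ N.erase v then 1 else 0) with hx
  have hsum : ∑ u, x u = 0 := by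
    rw [Finset.sum_sub_distrib, Finset.sum_ite_eq' Finset.univ v, if_pos (Finset.mem_univ v),
      Finset.sum_ite_mem, Finset.univ_inter, Finset.sum_const, nsmul_eq_mul, hcard]
    ring
  have hsq : x ⬝ᵥ x = d * (d + 1) := by
    have h1 : ∀ u, x u * x u =
        (if u = v then d ^ 2 else 0) + (if u ∈ N.erase v then 1 else 0) := by
      intro u
      by_cases h : u = v
      · simp [hx, h, sq]
      · by_cases h2 : u ∈ N <;> simp [hx, h, h2]
    simp only [dotProduct, h1, Finset.sum_add_distrib]
    rw [Finset.sum_ite_eq' Finset.univ v, if_pos (Finset.mem_univ v),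
      Finset.sum_ite_mem, Finset.univ_inter, Finset.sum_const, nsmul_eq_mul, hcard]
    ring
  have hform : 2 * (d * (d + 1) ^ 2 + ε) ≤ G.nonadjForm x := by
    -- Only the pairs joining `v` to its non-neighbours and the pair `a`, `b` are counted.
    have h1 : ∑ u, ∑ w, (((if u = v then (if w ∈ N.erase v then (d + 1) ^ 2 else 0) else 0) +
        (if w = v then (if u ∈ N.erase v then (d + 1) ^ 2 else 0) else 0)) +
        ((if u = a then (if w = b then ε else 0) else 0) +
        (if w = a then (if u = b then ε else 0) else 0))) = 2 * (d * (d + 1) ^ 2 + ε) := by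
      simp only [Finset.sum_add_distrib]
      rw [Finset.sum_comm (f := fun u w => if w = v then
          (if u ∈ N.erase v then (d + 1) ^ 2 else 0) else 0),
        Finset.sum_comm (f := fun u w => if w = a then (if u = b then ε else 0) else 0)]
      have h2 : ∀ (z : V) (f : V → ℝ), ∑ u, ∑ w, (if u = z then f w else 0) = ∑ w, f w := by
        intro z f
        rw [Finset.sum_comm]
        exact Finset.sum_congr rfl fun w _ => by
          rw [Finset.sum_ite_eq' Finset.univ z, if_pos (Finset.mem_univ z)]
      simp only [h2]
      rw [Finset.sum_ite_mem, Finset.univ_inter, Finset.sum_const, nsmul_eq_mul, hcard,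
        Finset.sum_ite_eq' Finset.univ b, if_pos (Finset.mem_univ b)]
      ring
    rw [← h1]
    refine Finset.sum_le_sum fun u _ => Finset.sum_le_sum fun w _ => ?_
    have hN' : ∀ z, z ∈ N ↔ ¬ G.Adj v z := fun z => mem_nonNeighborFinset
    have hmem : ∀ z, z ∈ N.erase v ↔ z ≠ v ∧ ¬ G.Adj v z := by simp [hN']
    have hxv : x v = d := by simp [hx]
    have hxN : ∀ z, z ≠ v → ¬ G.Adj v z → x z = -1 := fun z h1 h2 => by
      simp [hx, h1, hN', h2]
    have hva : v ≠ a := Ne.symm hav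
    have hvb : (if v = b then ε else 0) = 0 := by
      split_ifs with h
      · rcases hε with h0 | ⟨-, -, h2⟩
        · exact h0
        · exact absurd h h2.ne
      · rfl
    simp only [hmem]
    by_cases huv : u = v
    · subst huv
      simp only [if_true, if_neg hva, hvb, ite_self, add_zero]
      by_cases hwu : w = u
      · simp [hwu]
      · by_cases hw : G.Adj u w
        · simp [hwu, hw]
        · simp [hwu, hw, hxv, hxN w hwu hw]
    by_cases hwv : w = v
    · subst hwv
      simp only [if_true, if_neg hva, hvb, ite_self, add_zero, if_neg huv, zero_add]
      by_cases hu : G.Adj w u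
      · simp [hu, hu.symm]
      · have hu' : ¬ G.Adj u w := fun h => hu h.symm
        rw [if_pos ⟨huv, hu⟩, if_neg hu', hxN u huv hu, hxv]
        exact le_of_eq (by ring)
    simp only [if_neg huv, if_neg hwv, add_zero, zero_add]
    rcases hε with rfl | ⟨rfl, hab, hadj⟩
    · simp only [ite_self, add_zero]
      split_ifs
      exacts [le_rfl, sq_nonneg _]
    have hba : b ≠ a := fun h => ha (h ▸ hadj)
    have hxa : x a = -1 := hxN a hav ha
    have hxb : x b = 0 := by simp [hx, hadj.ne', hN', hadj]
    by_cases h1 : u = a ∧ w = b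
    · rw [h1.1, h1.2]
      simp [hab, hba, hxa, hxb]
    by_cases h2 : w = a ∧ u = b
    · rw [h2.1, h2.2]
      have : ¬ G.Adj b a := fun h => hab h.symm
      simp [this, hba, hxa, hxb]
    simp only [← ite_and, if_neg h1, if_neg h2, add_zero]
    split_ifs
    exacts [le_rfl, sq_nonneg _]
  have h := hG.nonadjForm_le_of_distLapRadius_le hc hsum
  rw [hsq] at h
  linarith

lemma exists_ne_mem_of_one_lt_card {v : V} (h : 1 < (G.nonNeighborFinset v).card) :
    ∃ a, a ≠ v ∧ ¬ G.Adj v a := by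
  obtain ⟨a, ha, hav⟩ := Finset.exists_mem_ne h v
  exact ⟨a, hav, mem_nonNeighborFinset.mp ha⟩

lemma Connected.card_add_card_nonNeighborFinset_le (hG : G.Connected) {c : ℝ}
    (hc : G.distLapRadius ≤ c) {v : V} (h : 1 < (G.nonNeighborFinset v).card) :
    (Fintype.card V : ℝ) + (G.nonNeighborFinset v).card ≤ c := by
  obtain ⟨a, hav, ha⟩ := exists_ne_mem_of_one_lt_card h
  have h1 := hG.rayleigh_test_vector (b := a) hc hav ha (Or.inl rfl)
  have h2 : (1 : ℝ) < (G.nonNeighborFinset v).card := by exact_mod_cast h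
  set m : ℝ := ((G.nonNeighborFinset v).card : ℝ)
  simp only at h1
  have h3 : 0 < (m - 1) * (m - 1 + 1) := by nlinarith
  refine le_of_mul_le_mul_right ?_ h3
  linarith

/-- In the extremal case the test vector is optimal, which leaves no edge of the complement going
out of the closed neighbourhood of `v`. -/
lemma Connected.not_adj_of_card_nonNeighborFinset_eq (hG : G.Connected) {v a b : V}
    (h : 1 < (G.nonNeighborFinset v).card)
    (hc : G.distLapRadius ≤ Fintype.card V + (G.nonNeighborFinset v).card)
    (ha : ¬ G.Adj v a) (hab : ¬ G.Adj a b) : ¬ G.Adj v b := by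
  intro hvb
  have hav : a ≠ v := by
    rintro rfl
    exact hab hvb
  have h1 := hG.rayleigh_test_vector hc hav ha (Or.inr ⟨rfl, hab, hvb⟩)
  simp only at h1
  linarith

/-! ### Greedy cliques -/

/-- If every vertex has at most `k` non-neighbours (itself included), and those with exactly `k` of
them have a non-neighbourhood closed under non-adjacency, then picking vertices greedily gives a
clique which meets the bound `#S ≤ (k - 1) * #I` up to the number of independent classes of size
`k`. A class that is not independent contributes two vertices to the clique, which is at least its
share since `k ≤ 2 * (k - 1)`. -/
theorem exists_isClique_and_classes {k : ℕ} (hk : 2 ≤ k)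
    (hcard : ∀ v, (G.nonNeighborFinset v).card ≤ k)
    (hclosed : ∀ v u w, (G.nonNeighborFinset v).card = k → ¬ G.Adj v u → ¬ G.Adj u w →
      ¬ G.Adj v w) (S : Finset V) :
    ∃ I ⊆ S, G.IsClique (I : Set V) ∧ ∃ 𝒞 : Finset (Finset V),
      (∀ C ∈ 𝒞, C ⊆ S ∧ C.card = k ∧ ∀ u ∈ C, ∀ w, w ∈ C ↔ ¬ G.Adj u w) ∧
      S.card ≤ (k - 1) * I.card + 𝒞.card := by
  classical
  induction S using Finset.strongInduction with
  | H S ih =>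
    rcases S.eq_empty_or_nonempty with rfl | ⟨v₀, hv₀⟩
    · exact ⟨∅, Finset.Subset.refl _, by simp, ∅, by simp, by simp⟩
    by_cases hsmall : ∃ v ∈ S, (G.nonNeighborFinset v ∩ S).card ≤ k - 1
    · obtain ⟨v, hv, hvk⟩ := hsmall
      obtain ⟨I, hIS, hI, 𝒞, h𝒞, hle⟩ := ih (S \ G.nonNeighborFinset v)
        (Finset.ssubset_iff_subset_ne.mpr ⟨Finset.sdiff_subset, fun h => by
          rw [← h] at hv
          exact (Finset.mem_sdiff.mp hv).2 (self_mem_nonNeighborFinset v)⟩)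
      have hadj : ∀ u ∈ I, G.Adj v u := fun u hu => by
        have := (Finset.mem_sdiff.mp (hIS hu)).2
        simpa using this
      have hvI : v ∉ I := fun h => G.loopless.irrefl v (hadj v h)
      refine ⟨insert v I, Finset.insert_subset hv (hIS.trans Finset.sdiff_subset), ?_, 𝒞,
        fun C hC => ⟨(h𝒞 C hC).1.trans Finset.sdiff_subset, (h𝒞 C hC).2⟩, ?_⟩
      · rw [Finset.coe_insert, isClique_insert]
        exact ⟨hI, fun u hu _ => hadj u hu⟩
      · rw [Finset.card_insert_of_notMem hvI, mul_add, mul_one]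
        have := Finset.card_sdiff_add_card_inter S (G.nonNeighborFinset v)
        rw [Finset.inter_comm] at this
        omega
    · push Not at hsmall
      have hsub : G.nonNeighborFinset v₀ ⊆ S ∧ (G.nonNeighborFinset v₀).card = k := by
        have h1 := hsmall v₀ hv₀
        have h2 := hcard v₀
        have h3 := Finset.card_le_card
          (Finset.inter_subset_left (s₁ := G.nonNeighborFinset v₀) (s₂ := S))
        refine ⟨Finset.inter_eq_left.mp
          (Finset.eq_of_subset_of_card_le Finset.inter_subset_left ?_), ?_⟩ <;> omega
      obtain ⟨hNS, hNk⟩ := hsub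
      obtain ⟨I, hIS, hI, 𝒞, h𝒞, hle⟩ := ih (S \ G.nonNeighborFinset v₀)
        (Finset.ssubset_iff_subset_ne.mpr ⟨Finset.sdiff_subset, fun h => by
          rw [← h] at hv₀
          exact (Finset.mem_sdiff.mp hv₀).2 (self_mem_nonNeighborFinset v₀)⟩)
      have hSle : S.card = (S \ G.nonNeighborFinset v₀).card + k := by
        rw [← hNk, Finset.card_sdiff_add_card_eq_card hNS]
      have hadj : ∀ z, ¬ G.Adj v₀ z → ∀ u ∈ I, G.Adj z u := fun z hz u hu => by
        have h1 := (Finset.mem_sdiff.mp (hIS hu)).2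
        by_contra h2
        exact h1 (mem_nonNeighborFinset.mpr (hclosed v₀ z u hNk hz h2))
      have hnot : ∀ z, ¬ G.Adj v₀ z → z ∉ I := fun z hz h => G.loopless.irrefl z (hadj z hz z h)
      by_cases hind : ∀ u w, ¬ G.Adj v₀ u → ¬ G.Adj v₀ w → ¬ G.Adj u w
      · refine ⟨insert v₀ I, Finset.insert_subset hv₀ (hIS.trans Finset.sdiff_subset), ?_,
          insert (G.nonNeighborFinset v₀) 𝒞, ?_, ?_⟩
        · rw [Finset.coe_insert, isClique_insert]
          exact ⟨hI, fun u hu _ => hadj v₀ (G.loopless.irrefl v₀) u hu⟩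
        · intro C hC
          rcases Finset.mem_insert.mp hC with rfl | hC
          · refine ⟨hNS, hNk, fun u hu w => ?_⟩
            rw [mem_nonNeighborFinset] at hu ⊢
            exact ⟨fun h => hind u w hu h, fun h => hclosed v₀ u w hNk hu h⟩
          · exact ⟨(h𝒞 C hC).1.trans Finset.sdiff_subset, (h𝒞 C hC).2⟩
        · have hN : G.nonNeighborFinset v₀ ∉ 𝒞 := fun h => by
            have := (h𝒞 _ h).1 (self_mem_nonNeighborFinset v₀)
            exact (Finset.mem_sdiff.mp this).2 (self_mem_nonNeighborFinset v₀)
          rw [Finset.card_insert_of_notMem hN,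
            Finset.card_insert_of_notMem (hnot v₀ (G.loopless.irrefl v₀)), mul_add, mul_one]
          omega
      · push Not at hind
        obtain ⟨u, w, hu, hw, huw⟩ := hind
        have huwI : u ∉ insert w I := fun h => by
          rcases Finset.mem_insert.mp h with h | h
          · exact huw.ne h
          · exact hnot u hu h
        refine ⟨insert u (insert w I), Finset.insert_subset (hNS (by simpa using hu))
          (Finset.insert_subset (hNS (by simpa using hw)) (hIS.trans Finset.sdiff_subset)),
          ?_, 𝒞, fun C hC => ⟨(h𝒞 C hC).1.trans Finset.sdiff_subset, (h𝒞 C hC).2⟩, ?_⟩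
        · rw [Finset.coe_insert, Finset.coe_insert, isClique_insert, isClique_insert]
          refine ⟨⟨hI, fun z hz _ => hadj w hw z hz⟩, fun z hz _ => ?_⟩
          rcases hz with rfl | hz
          · exact huw
          · exact hadj u hu z hz
        · rw [Finset.card_insert_of_notMem huwI, Finset.card_insert_of_notMem (hnot w hw),
            mul_add, mul_add, mul_one]
          omega

/-- The greedy bound: some vertex has at least `n / ω` non-neighbours, itself included. -/
lemma card_le_mul_cliqueNum {m : ℕ} (hm : 1 ≤ m) (h : ∀ v, (G.nonNeighborFinset v).card ≤ m) :
    Fintype.card V ≤ m * G.cliqueNum := by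
  obtain ⟨I, -, hI, 𝒞, h𝒞, hle⟩ := G.exists_isClique_and_classes (k := m + 1) (by omega)
    (fun v => (h v).trans (Nat.le_succ m))
    (fun v _ _ hv => absurd (h v) (by omega)) Finset.univ
  have h0 : 𝒞 = ∅ := by
    refine Finset.eq_empty_of_forall_notMem fun C hC => ?_
    obtain ⟨-, hCk, hCu⟩ := h𝒞 C hC
    obtain ⟨u, hu⟩ := Finset.card_pos.mp (hCk ▸ Nat.succ_pos m : 0 < C.card)
    have : C = G.nonNeighborFinset u := by
      ext w
      rw [hCu u hu w, mem_nonNeighborFinset]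
    have h2 := h u
    rw [← this] at h2
    omega
  rw [h0, Finset.card_empty, add_zero, Finset.card_univ, Nat.add_sub_cancel] at hle
  exact hle.trans (Nat.mul_le_mul_left m hI.card_le_cliqueNum)

/-- The lower bound on the distance Laplacian radius. -/
theorem Connected.card_add_le_distLapRadius (hG : G.Connected) (hne : G ≠ ⊤) {k : ℕ}
    (hk : (k - 1) * G.cliqueNum < Fintype.card V) :
    (Fintype.card V : ℝ) + k ≤ G.distLapRadius := by
  have := hG.nonempty
  obtain ⟨v, -, hv⟩ := Finset.exists_max_image Finset.univ
    (fun v => (G.nonNeighborFinset v).card) Finset.univ_nonempty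
  obtain ⟨a, b, hab, hadj⟩ : ∃ a b, a ≠ b ∧ ¬ G.Adj a b := by
    by_contra h
    push Not at h
    exact hne (eq_top_iff.mpr fun a b hab => h a b hab)
  have h1 : 1 < (G.nonNeighborFinset v).card := by
    refine lt_of_lt_of_le ?_ (hv a (Finset.mem_univ a))
    exact Finset.one_lt_card.mpr ⟨a, self_mem_nonNeighborFinset a, b, by simpa using hadj, hab⟩
  have h2 := card_le_mul_cliqueNum h1.le fun u => hv u (Finset.mem_univ u)
  have h3 : k ≤ (G.nonNeighborFinset v).card := by
    by_contra h
    have := Nat.mul_le_mul_right G.cliqueNum (show (G.nonNeighborFinset v).card ≤ k - 1 by omega)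
    omega
  refine le_trans ?_ (hG.card_add_card_nonNeighborFinset_le le_rfl h1)
  have : (k : ℝ) ≤ (G.nonNeighborFinset v).card := by exact_mod_cast h3
  linarith

end

end SimpleGraph

/-! ### The join of edgeless graphs with a graph -/

namespace SimpleGraph

open Matrix

/-- The join of `t` edgeless graphs of order `k` with the graph `H`. -/
abbrev edgelessJoin {W : Type*} (t k : ℕ) (H : SimpleGraph W) :
    SimpleGraph ((Σ _ : Fin t, Fin k) ⊕ W) :=
  graphJoin (iJoin fun _ : Fin t => (⊥ : SimpleGraph (Fin k))) H

section

variable {W : Type*} {t k : ℕ} {H : SimpleGraph W}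

@[simp]
lemma edgelessJoin_adj_inl_inl {p q : Σ _ : Fin t, Fin k} :
    (edgelessJoin t k H).Adj (Sum.inl p) (Sum.inl q) ↔ p.1 ≠ q.1 := by
  simp [edgelessJoin, graphJoin, iJoin]

@[simp]
lemma edgelessJoin_adj_inl_inr {p : Σ _ : Fin t, Fin k} {w : W} :
    (edgelessJoin t k H).Adj (Sum.inl p) (Sum.inr w) := by
  simp [edgelessJoin, graphJoin]

@[simp]
lemma edgelessJoin_adj_inr_inl {p : Σ _ : Fin t, Fin k} {w : W} :
    (edgelessJoin t k H).Adj (Sum.inr w) (Sum.inl p) := by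
  simp [edgelessJoin, graphJoin]

@[simp]
lemma edgelessJoin_adj_inr_inr {v w : W} :
    (edgelessJoin t k H).Adj (Sum.inr v) (Sum.inr w) ↔ H.Adj v w := by
  simp [edgelessJoin, graphJoin]

lemma cliqueNum_edgelessJoin [Fintype W] (hk : 0 < k) :
    (edgelessJoin t k H).cliqueNum = t + H.cliqueNum := by
  classical
  apply le_antisymm
  · obtain ⟨s, hs⟩ := (edgelessJoin t k H).exists_isNClique_cliqueNum
    rw [← hs.card_eq, ← Finset.card_toLeft_add_card_toRight (u := s)]
    refine add_le_add ?_ ?_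
    · have h1 : (s.toLeft.image Sigma.fst).card = s.toLeft.card := by
        refine Finset.card_image_of_injOn fun p hp q hq hpq => ?_
        by_contra hne
        refine edgelessJoin_adj_inl_inl.mp (hs.isClique (Finset.mem_toLeft.mp hp)
          (Finset.mem_toLeft.mp hq) fun h => hne (Sum.inl_injective h)) hpq
      rw [← h1]
      exact (Finset.card_le_univ _).trans (Fintype.card_fin t).le
    · have h2 : H.IsClique (s.toRight : Set W) := fun v hv w hw hvw =>
        edgelessJoin_adj_inr_inr.mp (hs.isClique (Finset.mem_toRight.mp hv)
          (Finset.mem_toRight.mp hw) fun h => hvw (Sum.inr_injective h))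
      exact h2.card_le_cliqueNum
  · obtain ⟨s, hs⟩ := H.exists_isNClique_cliqueNum
    set T : Finset (Σ _ : Fin t, Fin k) :=
      Finset.univ.image fun i => ⟨i, ⟨0, hk⟩⟩ with hT
    have hTcard : T.card = t := by
      rw [hT, Finset.card_image_of_injective _ fun i j h => congrArg Sigma.fst h]
      simp
    refine le_of_eq_of_le (b := (T.disjSum s).card)
      (by rw [Finset.card_disjSum, hTcard, hs.card_eq]) ?_
    refine IsClique.card_le_cliqueNum (G := edgelessJoin t k H) (t := T.disjSum s) (tc := ?_)
    rintro (p | v) hp (q | w) hq hne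
    · rw [edgelessJoin_adj_inl_inl]
      intro hpq
      rw [Finset.mem_coe, Finset.inl_mem_disjSum, hT, Finset.mem_image] at hp hq
      obtain ⟨i, -, rfl⟩ := hp
      obtain ⟨j, -, rfl⟩ := hq
      obtain rfl : i = j := hpq
      exact hne rfl
    · exact edgelessJoin_adj_inl_inr
    · exact edgelessJoin_adj_inr_inl
    · rw [Finset.mem_coe, Finset.inr_mem_disjSum] at hp hq
      exact edgelessJoin_adj_inr_inr.mpr (hs.isClique hp hq fun h => hne (by rw [h]))

lemma dist_edgelessJoin_le_two [Nonempty W] (ht : 0 < t) (hk : 0 < k)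
    (u v : (Σ _ : Fin t, Fin k) ⊕ W) : (edgelessJoin t k H).dist u v ≤ 2 := by
  have w : W := Classical.arbitrary W
  have h1 : ∀ {u v}, (edgelessJoin t k H).Adj u v → (edgelessJoin t k H).dist u v ≤ 2 :=
    fun h => by rw [dist_eq_one_iff_adj.mpr h]; norm_num
  rcases u with p | u <;> rcases v with q | v
  · exact dist_le_two_of_common_neighbor (w := Sum.inr w) edgelessJoin_adj_inl_inr
      edgelessJoin_adj_inr_inl
  · exact h1 edgelessJoin_adj_inl_inr
  · exact h1 edgelessJoin_adj_inr_inl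
  · exact dist_le_two_of_common_neighbor (w := Sum.inl ⟨⟨0, ht⟩, ⟨0, hk⟩⟩)
      edgelessJoin_adj_inr_inl edgelessJoin_adj_inl_inr

lemma nonadjForm_le_edgelessJoin [Fintype W] (y : W → ℝ) :
    H.nonadjForm y ≤ (edgelessJoin t k H).nonadjForm (Sum.elim 0 y) := by
  classical
  unfold nonadjForm
  rw [Fintype.sum_sum_type]
  refine le_add_of_nonneg_of_le ?_ ?_
  · refine Finset.sum_nonneg fun u _ => Finset.sum_nonneg fun v _ => ?_
    split_ifs
    exacts [le_rfl, sq_nonneg _]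
  · refine Finset.sum_le_sum fun u _ => ?_
    rw [Fintype.sum_sum_type]
    simp

lemma nonadjForm_edgelessJoin_le [Fintype W]
    (h : ∀ y : W → ℝ, H.nonadjForm y ≤ 2 * (k * (y ⬝ᵥ y)))
    (x : (Σ _ : Fin t, Fin k) ⊕ W → ℝ) :
    (edgelessJoin t k H).nonadjForm x ≤ 2 * (k * (x ⬝ᵥ x)) := by
  classical
  have h1 : (edgelessJoin t k H).nonadjForm x =
      (iJoin fun _ : Fin t => (⊥ : SimpleGraph (Fin k))).nonadjForm (x ∘ Sum.inl) +
        H.nonadjForm (x ∘ Sum.inr) := by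
    simp only [nonadjForm, Fintype.sum_sum_type, edgelessJoin_adj_inl_inl,
      edgelessJoin_adj_inl_inr, edgelessJoin_adj_inr_inl, edgelessJoin_adj_inr_inr, if_true,
      Finset.sum_const_zero, add_zero, zero_add, Function.comp_apply]
    congr 1
    simp [iJoin]
  have h2 : x ⬝ᵥ x = (x ∘ Sum.inl) ⬝ᵥ (x ∘ Sum.inl) + (x ∘ Sum.inr) ⬝ᵥ (x ∘ Sum.inr) := by
    simp [dotProduct, Fintype.sum_sum_type]
  have h3 := nonadjForm_le_of_fiber_card_le (k := k)
    (G := iJoin fun _ : Fin t => (⊥ : SimpleGraph (Fin k))) Sigma.fst (fun i => by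
      refine le_of_le_of_eq (Finset.card_le_card_of_injOn (t := (Finset.univ : Finset (Fin k)))
        (fun p => p.2) (fun _ _ => Finset.mem_univ _) ?_) (by simp)
      rintro ⟨_, a⟩ hp ⟨_, b⟩ hq hab
      obtain rfl := (Finset.mem_filter.mp hp).2
      obtain rfl := (Finset.mem_filter.mp hq).2
      exact congrArg _ hab) (fun u v huv => Or.inl huv) (x ∘ Sum.inl)
  have h4 := h (x ∘ Sum.inr)
  rw [h1, h2]
  linarith

lemma Iso.cliqueNum_le {V : Type*} [Fintype W] {G : SimpleGraph V} (e : G ≃g H) :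
    G.cliqueNum ≤ H.cliqueNum := by
  obtain ⟨s, hs⟩ := G.exists_isNClique_cliqueNum
  rw [← hs.card_eq, ← Finset.card_map e.toEquiv.toEmbedding]
  refine IsClique.card_le_cliqueNum (tc := ?_)
  rw [Finset.coe_map]
  rintro _ ⟨u, hu, rfl⟩ _ ⟨v, hv, rfl⟩ hne
  exact e.map_adj_iff.mpr (hs.isClique hu hv fun h => hne (by rw [h]))

lemma Iso.cliqueNum_eq {V : Type*} [Fintype V] [Fintype W] {G : SimpleGraph V} (e : G ≃g H) :
    G.cliqueNum = H.cliqueNum :=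
  le_antisymm (Iso.cliqueNum_le e) (Iso.cliqueNum_le e.symm)

lemma eq_bot_of_cliqueNum_le_one [Finite W] (h : H.cliqueNum ≤ 1) : H = ⊥ := by
  classical
  refine eq_bot_iff.mpr fun a b hab => ?_
  have h1 : H.IsClique (({a, b} : Finset W) : Set W) := by
    rw [Finset.coe_insert, Finset.coe_singleton, isClique_pair]
    exact fun _ => hab
  have h2 := h1.card_le_cliqueNum
  rw [Finset.card_pair hab.ne] at h2
  omega

end

/-! ### Structure of the extremal graphs -/

section

variable {V : Type*} [Fintype V] {G : SimpleGraph V}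

/-- A graph in which `t` independent sets of size `k` are classes of non-adjacency is a join. -/
lemma exists_iso_edgelessJoin_of_classes {n k t : ℕ} (hn : Fintype.card V = n)
    (𝒞 : Finset (Finset V)) (ht : 𝒞.card = t)
    (h𝒞 : ∀ C ∈ 𝒞, C.card = k ∧ ∀ u ∈ C, ∀ w, w ∈ C ↔ ¬ G.Adj u w) :
    ∃ H : SimpleGraph (Fin (n - k * t)), Nonempty (G ≃g edgelessJoin t k H) := by
  classical
  have hdisj : ∀ C ∈ 𝒞, ∀ D ∈ 𝒞, ∀ u, u ∈ C → u ∈ D → C = D := by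
    intro C hC D hD u huC huD
    ext w
    rw [(h𝒞 C hC).2 u huC w, (h𝒞 D hD).2 u huD w]
  have hU : (𝒞.biUnion id).card = k * t := by
    rw [Finset.card_biUnion, Finset.sum_congr (f := fun C => (id C).card) (g := fun _ => k) rfl
      fun C hC => (h𝒞 C hC).1, Finset.sum_const, ht, smul_eq_mul, mul_comm]
    intro C hC D hD hne
    exact Finset.disjoint_left.mpr fun u hu hu' => hne (hdisj C hC D hD u hu hu')
  have hle : k * t ≤ n := by
    rw [← hU, ← hn]
    exact Finset.card_le_univ _
  have hR : (𝒞.biUnion id)ᶜ.card = n - k * t := by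
    rw [Finset.card_compl, hU, hn]
  set eC : Fin t ≃ 𝒞 := (𝒞.equivFinOfCardEq ht).symm
  set eF : ∀ i, Fin k ≃ (eC i).1 := fun i =>
    ((eC i).1.equivFinOfCardEq (h𝒞 _ (eC i).2).1).symm
  set eR : Fin (n - k * t) ≃ ((𝒞.biUnion id)ᶜ : Finset V) :=
    ((𝒞.biUnion id)ᶜ.equivFinOfCardEq hR).symm
  set φ : (Σ _ : Fin t, Fin k) ⊕ Fin (n - k * t) → V :=
    Sum.elim (fun p => (eF p.1 p.2).1) (fun b => (eR b).1) with hφ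
  have hsep : ∀ p b, φ (Sum.inr b) ∉ (eC p).1 := by
    intro p b hb
    have h1 := (eR b).2
    rw [Finset.mem_compl] at h1
    exact h1 (Finset.mem_biUnion.mpr ⟨_, (eC p).2, hb⟩)
  have hin : ∀ p : Σ _ : Fin t, Fin k, φ (Sum.inl p) ∈ (eC p.1).1 := fun p => (eF p.1 p.2).2
  have hclass : ∀ p q : Σ _ : Fin t, Fin k, φ (Sum.inl q) ∈ (eC p.1).1 → p.1 = q.1 := by
    intro p q h
    exact eC.injective (Subtype.ext (hdisj _ (eC p.1).2 _ (eC q.1).2 _ h (hin q)))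
  have hinj : Function.Injective φ := by
    rintro (p | b) (q | c) h
    · have h1 : p.1 = q.1 := hclass p q (h ▸ hin p)
      obtain ⟨i, a⟩ := p
      obtain ⟨j, b⟩ := q
      obtain rfl : i = j := h1
      have h2 : a = b := (eF i).injective (Subtype.ext h)
      rw [h2]
    · exact absurd (h ▸ hin p) (hsep p.1 c)
    · exact absurd (h.symm ▸ hin q) (hsep q.1 b)
    · exact congrArg Sum.inr (eR.injective (Subtype.ext h))
  have hbij : Function.Bijective φ := by
    rw [Fintype.bijective_iff_injective_and_card]
    refine ⟨hinj, ?_⟩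
    simp only [Fintype.card_sum, Fintype.card_sigma, Fintype.card_fin, Finset.sum_const,
      Finset.card_univ, smul_eq_mul, hn]
    rw [mul_comm t k]
    omega
  refine ⟨G.comap (φ ∘ Sum.inr), ⟨Iso.symm ⟨Equiv.ofBijective φ hbij, ?_⟩⟩⟩
  rintro (p | b) (q | c)
  · rw [edgelessJoin_adj_inl_inl, Equiv.ofBijective_apply, Equiv.ofBijective_apply]
    have h1 := (h𝒞 _ (eC p.1).2).2 _ (hin p) (φ (Sum.inl q))
    constructor
    · intro h hpq
      exact h1.mp (by rw [hpq]; exact hin q) h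
    · intro h
      by_contra h2
      exact h (hclass p q (h1.mpr h2))
  · simp only [edgelessJoin_adj_inl_inr, Equiv.ofBijective_apply, iff_true]
    by_contra h2
    exact hsep p.1 c (((h𝒞 _ (eC p.1).2).2 _ (hin p) _).mpr h2)
  · simp only [edgelessJoin_adj_inr_inl, Equiv.ofBijective_apply, iff_true]
    by_contra h2
    exact hsep q.1 b (((h𝒞 _ (eC q.1).2).2 _ (hin q) _).mpr fun h => h2 h.symm)
  · rw [edgelessJoin_adj_inr_inr]
    rfl

/-- If the distance Laplacian radius is at most `n + k`, where `n = (k - 1) * ω + t`, the greedy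
argument finds at least `t` independent classes of size `k`. -/
theorem Connected.exists_iso_edgelessJoin (hG : G.Connected) {n k t : ℕ}
    (hn : Fintype.card V = n) (hk : 2 ≤ k)
    (hcard : n + G.cliqueNum = k * G.cliqueNum + t) (hr : G.distLapRadius ≤ n + k) :
    ∃ H : SimpleGraph (Fin (n - k * t)), Nonempty (G ≃g edgelessJoin t k H) := by
  have hle : ∀ v, (G.nonNeighborFinset v).card ≤ k := by
    intro v
    by_cases h : 1 < (G.nonNeighborFinset v).card
    · have h1 := hG.card_add_card_nonNeighborFinset_le hr h
      rw [hn] at h1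
      have h2 : ((G.nonNeighborFinset v).card : ℝ) ≤ k := by linarith
      exact_mod_cast h2
    · omega
  have hclosed : ∀ v u w, (G.nonNeighborFinset v).card = k → ¬ G.Adj v u → ¬ G.Adj u w →
      ¬ G.Adj v w := fun v u w hv hu hw =>
    hG.not_adj_of_card_nonNeighborFinset_eq (by omega) (by rw [hv, hn]; exact hr) hu hw
  obtain ⟨I, -, hI, 𝒞, h𝒞, hS⟩ := exists_isClique_and_classes hk hle hclosed Finset.univ
  rw [Finset.card_univ, hn] at hS
  have ht : t ≤ 𝒞.card := by
    have h1 := Nat.mul_le_mul_left (k - 1) hI.card_le_cliqueNum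
    have h2 : k * G.cliqueNum = (k - 1) * G.cliqueNum + G.cliqueNum := by
      rw [← Nat.succ_mul, Nat.succ_eq_add_one, Nat.sub_add_cancel (by omega)]
    omega
  obtain ⟨𝒟, h𝒟, h𝒟t⟩ := Finset.exists_subset_card_eq ht
  exact exists_iso_edgelessJoin_of_classes hn 𝒟 h𝒟t fun C hC => (h𝒞 C (h𝒟 hC)).2

/-- Two extremal graphs with the same parameters are isomorphic when at most one vertex of a clique
can lie outside the edgeless parts, which makes the last factor of the join edgeless too. -/
theorem Connected.nonempty_iso_of_distLapRadius_le {W : Type*} [Fintype W] {G' : SimpleGraph W}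
    (hG : G.Connected) (hG' : G'.Connected) {n k t : ℕ} (hn : Fintype.card V = n)
    (hn' : Fintype.card W = n) (hω : G'.cliqueNum = G.cliqueNum) (hk : 2 ≤ k)
    (hcard : n + G.cliqueNum = k * G.cliqueNum + t) (ht : G.cliqueNum ≤ t + 1)
    (hr : G.distLapRadius ≤ n + k) (hr' : G'.distLapRadius ≤ n + k) :
    Nonempty (G ≃g G') := by
  obtain ⟨H, ⟨e⟩⟩ := hG.exists_iso_edgelessJoin hn hk hcard hr
  obtain ⟨H', ⟨e'⟩⟩ := hG'.exists_iso_edgelessJoin hn' hk (hω.symm ▸ hcard) hr'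
  have h1 := Iso.cliqueNum_eq e
  have h2 := Iso.cliqueNum_eq e'
  rw [cliqueNum_edgelessJoin (by omega)] at h1 h2
  obtain rfl : H = ⊥ := eq_bot_of_cliqueNum_le_one (by omega)
  obtain rfl : H' = ⊥ := eq_bot_of_cliqueNum_le_one (by omega)
  exact ⟨e.trans e'.symm⟩

end

/-! ### The distance Laplacian radius of a join -/

section

variable {t k m : ℕ} {H : SimpleGraph (Fin m)}

lemma distLapRadius_edgelessJoin_le (ht : 0 < t) (hk : 0 < k) (hm : 2 ≤ m)
    (h : (m : ℝ) - k ≤ H.algConnectivity) :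
    (edgelessJoin t k H).distLapRadius ≤ ((t * k + m : ℕ) : ℝ) + k := by
  have : Nonempty (Fin m) := ⟨⟨0, by omega⟩⟩
  have h1 := (card_sub_le_algConnectivity_iff H (by simpa using hm) k).mp (by simpa using h)
  have h2 := distLapRadius_le_of_dist_le_two (G := edgelessJoin t k H)
    (dist_edgelessJoin_le_two ht hk) (c := k)
    (nonadjForm_edgelessJoin_le (nonadjForm_le_of_sum_zero (Nat.cast_nonneg k) h1))
  simpa using h2

lemma le_algConnectivity_of_distLapRadius_edgelessJoin_le (hm : 2 ≤ m)
    (hconn : (edgelessJoin t k H).Connected)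
    (hr : (edgelessJoin t k H).distLapRadius ≤ ((t * k + m : ℕ) : ℝ) + k) :
    (m : ℝ) - k ≤ H.algConnectivity := by
  have h1 := card_sub_le_algConnectivity_iff H (by simpa using hm) k
  rw [Fintype.card_fin] at h1
  refine h1.mpr fun y hy => ?_
  have h2 := hconn.nonadjForm_le_of_distLapRadius_le hr (x := Sum.elim 0 y)
    (by simpa [Fintype.sum_sum_type] using hy)
  have h3 : (Sum.elim 0 y : (Σ _ : Fin t, Fin k) ⊕ Fin m → ℝ) ⬝ᵥ Sum.elim 0 y = y ⬝ᵥ y := by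
    simp [dotProduct, Fintype.sum_sum_type]
  have h4 : Fintype.card ((Σ _ : Fin t, Fin k) ⊕ Fin m) = t * k + m := by simp
  rw [h3, h4] at h2
  have h5 := nonadjForm_le_edgelessJoin (t := t) (k := k) (H := H) y
  linarith

end

/-! ### Turán graphs -/

section

variable {n ω : ℕ}

lemma cliqueNum_turanGraph (h0 : 0 < ω) (h : ω ≤ n) : (turanGraph n ω).cliqueNum = ω := by
  apply le_antisymm
  · by_contra hlt
    obtain ⟨s, hs⟩ := (turanGraph n ω).exists_isNClique_cliqueNum
    exact (turanGraph_cliqueFree h0).mono (by omega) s hs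
  · have h1 := not_cliqueFree_of_isTuranMaximal (by simpa using h)
      (isTuranMaximal_turanGraph (n := n) h0)
    rw [CliqueFree] at h1
    push Not at h1
    obtain ⟨s, hs⟩ := h1
    exact hs.card_eq ▸ hs.isClique.card_le_cliqueNum

lemma dist_turanGraph_le_two (h : 2 ≤ ω) (hn : ω < n) (u v : Fin n) :
    (turanGraph n ω).Reachable u v ∧ (turanGraph n ω).dist u v ≤ 2 := by
  by_cases huv : (u : ℕ) % ω = v % ω
  · obtain ⟨w, hw⟩ : ∃ w : Fin n, (u : ℕ) % ω ≠ w % ω := by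
      by_cases h0 : (u : ℕ) % ω = 0
      · refine ⟨⟨1, by omega⟩, ?_⟩
        rw [h0, Nat.mod_eq_of_lt (show 1 < ω from h)]
        norm_num
      · exact ⟨⟨0, by omega⟩, by simpa using h0⟩
    have h1 : (turanGraph n ω).Adj u w := turanGraph_adj.mpr hw
    have h2 : (turanGraph n ω).Adj w v := turanGraph_adj.mpr fun h => hw (huv.trans h.symm)
    exact ⟨h1.reachable.trans h2.reachable, dist_le_two_of_common_neighbor h1 h2⟩
  · have h1 : (turanGraph n ω).Adj u v := turanGraph_adj.mpr huv
    exact ⟨h1.reachable, by rw [dist_eq_one_iff_adj.mpr h1]; norm_num⟩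

lemma connected_turanGraph (h : 2 ≤ ω) (hn : ω < n) : (turanGraph n ω).Connected :=
  have : Nonempty (Fin n) := ⟨⟨0, by omega⟩⟩
  ⟨fun u v => (dist_turanGraph_le_two h hn u v).1⟩

theorem distLapRadius_turanGraph (h : 2 ≤ ω) (hn : ω < n) {k : ℕ} (hk1 : (k - 1) * ω < n)
    (hk2 : n ≤ k * ω) : (turanGraph n ω).distLapRadius = n + k := by
  have hne : Nonempty (Fin n) := ⟨⟨0, by omega⟩⟩
  apply le_antisymm
  · have h1 := nonadjForm_le_of_fiber_card_le (G := turanGraph n ω) (k := k)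
      (fun v : Fin n => (⟨v % ω, Nat.mod_lt _ (by omega)⟩ : Fin ω)) (fun i => ?_)
      (fun u v huv => turanGraph_adj.mpr fun h => huv (Fin.ext h))
    · simpa using distLapRadius_le_of_dist_le_two
        (fun u v => (dist_turanGraph_le_two h hn u v).2) h1
    · -- The vertices of a class are determined by their quotients by `ω`, which are below `k`.
      rw [← Finset.card_range k]
      refine Finset.card_le_card_of_injOn (fun v => (v : ℕ) / ω) (fun v _ => ?_) ?_
      · rw [Finset.mem_coe, Finset.mem_range, Nat.div_lt_iff_lt_mul (by omega)]
        exact v.isLt.trans_le hk2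
      · intro u hu v hv huv
        simp only [Finset.coe_filter, Finset.mem_univ, true_and, Set.mem_ofPred_eq] at hu hv
        have h2 : (u : ℕ) % ω = v % ω := congrArg Fin.val (hu.trans hv.symm)
        refine Fin.ext ?_
        rw [← Nat.div_add_mod u ω, ← Nat.div_add_mod v ω, h2]
        simp only at huv
        rw [huv]
  · have h1 := (connected_turanGraph h hn).card_add_le_distLapRadius (k := k)
      (fun htop => by
        rcases turanGraph_eq_top.mp htop with h | h <;> omega)
      (by rw [cliqueNum_turanGraph (by omega) hn.le]; simpa using hk1)
    simpa using h1

end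

end SimpleGraph

/-! ### The extremal theorem -/

open SimpleGraph in
theorem theorem5p1 {V : Type*} [Fintype V] (G : SimpleGraph V) (hG : G.Connected)
    (n ω : ℕ) (hn : Fintype.card V = n) (hω : G.cliqueNum = ω) :
    (SimpleGraph.turanGraph n ω).distLapRadius ≤ G.distLapRadius ∧
    (G ≠ ⊤ →
      (SimpleGraph.turanGraph n ω).distLapRadius = (n : ℝ) + (⌈(n : ℝ) / (ω : ℝ)⌉ : ℝ)) ∧
    (∀ k : ℕ, n = k * ω ∨ n + 1 = k * ω →
      (G.distLapRadius = (SimpleGraph.turanGraph n ω).distLapRadius ↔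
        Nonempty (G ≃g SimpleGraph.turanGraph n ω))) ∧
    (∀ k t : ℕ, 0 < t → t + 1 < ω → n + ω = k * ω + t →
      (G.distLapRadius = (SimpleGraph.turanGraph n ω).distLapRadius ↔
        ∃ H : SimpleGraph (Fin (n - k * t)),
          H.cliqueNum = ω - t ∧
          (n : ℝ) - (k : ℝ) * ((t : ℝ) + 1) ≤ H.algConnectivity ∧
          Nonempty (G ≃g SimpleGraph.graphJoin
            (SimpleGraph.iJoin fun _ : Fin t => (⊥ : SimpleGraph (Fin k))) H))) := by
  have hV := hG.nonempty
  have hn1 : 1 ≤ n := hn ▸ Fintype.card_pos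
  by_cases hne : G = ⊤
  · -- A complete graph is its own Turán graph, and the last part is vacuous.
    subst hne
    have hωn : ω = n := by
      rw [← hω, ← hn]
      refine le_antisymm ?_ ?_
      · obtain ⟨s, hs⟩ := (⊤ : SimpleGraph V).exists_isNClique_cliqueNum
        exact hs.card_eq ▸ Finset.card_le_univ s
      · rw [← Finset.card_univ]
        exact IsClique.card_le_cliqueNum (tc := fun u _ v _ huv => huv)
    have htop : turanGraph n ω = ⊤ := turanGraph_eq_top.mpr (Or.inr hωn.ge)
    have e : (⊤ : SimpleGraph V) ≃g turanGraph n ω := by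
      rw [htop]
      exact Iso.completeGraph (Fintype.equivFinOfCardEq hn)
    have heq := Iso.distLapRadius_eq (e.connected_iff.mp hG) e
    refine ⟨heq.ge, fun h => absurd rfl h, fun k _ => ⟨fun _ => ⟨e⟩, fun _ => heq⟩, ?_⟩
    intro k t ht htω hk
    exfalso
    rw [hωn] at hk htω
    have h2 : t = (2 - k) * n := by
      rcases le_or_gt k 2 with h | h
      · interval_cases k <;> omega
      · have := Nat.mul_le_mul_right n (show 3 ≤ k from h)
        omega
    rcases Nat.eq_zero_or_pos (2 - k) with h | h
    · rw [h] at h2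
      omega
    · have := Nat.mul_le_mul_right n h
      omega
  obtain ⟨a, b, hab, hadj⟩ : ∃ a b, a ≠ b ∧ ¬ G.Adj a b := by
    by_contra h
    push Not at h
    exact hne (eq_top_iff.mpr fun a b hab => h a b hab)
  have hω2 : 2 ≤ ω := by
    by_contra h
    have h1 : G = ⊥ := eq_bot_of_cliqueNum_le_one (by omega)
    have h2 := hG.preconnected a b
    rw [h1, reachable_bot] at h2
    exact hab h2
  have hωn : ω < n := by
    obtain ⟨s, hs⟩ := G.exists_isNClique_cliqueNum
    rw [← hω, ← hn, ← hs.card_eq, ← Finset.card_univ]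
    refine Finset.card_lt_card (Finset.ssubset_univ_iff.mpr fun h => hadj ?_)
    exact hs.isClique (by simp [h]) (by simp [h]) hab
  have hT := connected_turanGraph hω2 hωn
  have hlow : ∀ k : ℕ, (k - 1) * ω < n → (n : ℝ) + k ≤ G.distLapRadius := fun k hk => by
    rw [← hn]
    exact hG.card_add_le_distLapRadius hne (by rw [hω, hn]; exact hk)
  have hTeq := fun k => distLapRadius_turanGraph (k := k) hω2 hωn
  have hTω : (turanGraph n ω).cliqueNum = ω := cliqueNum_turanGraph (by omega) hωn.le
  have hpred : ∀ k, 0 < k → k * ω = (k - 1) * ω + ω := fun k hk => by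
    rw [← Nat.succ_mul, Nat.succ_eq_add_one, Nat.sub_add_cancel hk]
  have hpos : ∀ k, n ≤ k * ω → 2 ≤ k := fun k hk => by
    by_contra h
    have := Nat.mul_le_mul_right ω (show k ≤ 1 by omega)
    omega
  obtain ⟨k₀, hk₀1, hk₀2⟩ : ∃ k : ℕ, (k - 1) * ω < n ∧ n ≤ k * ω := by
    refine ⟨(n - 1) / ω + 1, ?_, ?_⟩
    · have := Nat.div_mul_le_self (n - 1) ω
      rw [Nat.add_sub_cancel]
      omega
    · have := Nat.lt_div_mul_add (a := n - 1) (b := ω) (by omega)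
      rw [Nat.add_mul, one_mul]
      omega
  refine ⟨(hTeq k₀ hk₀1 hk₀2).trans_le (hlow k₀ hk₀1), fun _ => ?_, ?_, ?_⟩
  · have hk₀ := hpos k₀ hk₀2
    have hω0 : (0 : ℝ) < ω := by exact_mod_cast (by omega : 0 < ω)
    have hceil : ⌈(n : ℝ) / (ω : ℝ)⌉ = (k₀ : ℤ) := by
      rw [Int.ceil_eq_iff]
      constructor
      · rw [lt_div_iff₀ hω0]
        have h1 : (((k₀ - 1 : ℕ) : ℝ)) * ω < n := by exact_mod_cast hk₀1
        rw [Nat.cast_sub (by omega)] at h1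
        simpa using h1
      · rw [div_le_iff₀ hω0]
        exact_mod_cast hk₀2
    rw [hTeq k₀ hk₀1 hk₀2, hceil]
    simp
  · intro k hk
    have hk2 := hpos k (by omega)
    have h1 := hpred k (by omega)
    have hTk := hTeq k (by omega) (by omega)
    refine ⟨fun heq => ?_, fun ⟨e⟩ => Iso.distLapRadius_eq hT e⟩
    rw [hTk] at heq
    rcases hk with hk | hk
    · exact hG.nonempty_iso_of_distLapRadius_le hT hn (Fintype.card_fin n) (hTω.trans hω.symm) hk2
        (t := ω) (by rw [hω]; omega) (by omega) heq.le hTk.le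
    · exact hG.nonempty_iso_of_distLapRadius_le hT hn (Fintype.card_fin n) (hTω.trans hω.symm) hk2
        (t := ω - 1) (by rw [hω]; omega) (by omega) heq.le hTk.le
  · intro k t ht htω hk
    have hk0 : 0 < k := by
      rcases Nat.eq_zero_or_pos k with rfl | h
      · omega
      · exact h
    have h1 := hpred k hk0
    have hk1 : (k - 1) * ω < n := by omega
    have hkω : n ≤ k * ω := by omega
    have hk2 := hpos k hkω
    rw [hTeq k hk1 hkω]
    -- The last factor has order `(k - 1) * (ω - t)`, which is at least two.
    have hm : n = t * k + (k - 1) * (ω - t) := by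
      zify [show t ≤ ω by omega, show 1 ≤ k from hk0]
      have : (n : ℤ) + ω = k * ω + t := by exact_mod_cast hk
      linarith [this]
    have hm2 : 2 ≤ (k - 1) * (ω - t) :=
      le_trans (by omega : 2 ≤ 1 * (ω - t)) (Nat.mul_le_mul_right _ (by omega))
    have hcomm : t * k = k * t := mul_comm t k
    have hsum : t * k + (n - k * t) = n := by omega
    have hcast : ((n - k * t : ℕ) : ℝ) - k = (n : ℝ) - (k : ℝ) * ((t : ℝ) + 1) := by
      rw [Nat.cast_sub (by omega)]
      push_cast
      ring
    constructor
    · intro heq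
      obtain ⟨H, ⟨e⟩⟩ := hG.exists_iso_edgelessJoin hn hk2 (by rw [hω]; exact hk) heq.le
      have hJ := e.connected_iff.mp hG
      refine ⟨H, ?_, ?_, ⟨e⟩⟩
      · have h2 := Iso.cliqueNum_eq e
        rw [cliqueNum_edgelessJoin hk0, hω] at h2
        omega
      · rw [← hcast]
        refine le_algConnectivity_of_distLapRadius_edgelessJoin_le (by omega) hJ ?_
        rw [hsum, ← Iso.distLapRadius_eq hJ e, heq]
    · rintro ⟨H, -, hH, ⟨e⟩⟩
      refine le_antisymm ?_ (hlow k hk1)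
      rw [← hcast] at hH
      have h2 := distLapRadius_edgelessJoin_le ht hk0 (by omega) hH
      rw [hsum] at h2
      exact (Iso.distLapRadius_eq (e.connected_iff.mp hG) e).trans_le h2
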